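/- **Theorem 1.1.** Let $S$ be a semigroup and let $T$ be a subsemigroup of $S$ such that the set $S\setminus T$ is finite. If $S$ has a finite complete rewriting system, then so does $T$. Here, for a set $A$, $A^+$ denotes the free semigroup of all nonempty words over $A$, and $A^*=A^+\cup\{\epsilon\}$ the free monoid. A rewriting system $R$ over $A$ is a subset of $A^+\times A^+$, whose elements are written $X\to Y$. One writes $W_1\to_R W_2$ if $W_1=Z_1XZ_2$ and $W_2=Z_1YZ_2$ for some rule $X\to Y$ in $R$ and some $Z_1,Z_2\in A^*$, and $\to_R^*$ denotes the reflexive transitive closure of $\to_R$ on $A^+$. The system $R$ is complete if it is Noetherian (there is no infinite sequence $W_1\to_R W_2\to_R W_3\to_R\cdots$) and confluent (whenever $U\to_R^*V$ and $U\to_R^*W$, there is $X\in A^+$ with $V\to_R^*X$ and $W\to_R^*X$). A semigroup has a finite complete rewriting system if there are a finite set $A$ and a finite complete rewriting system $R$ over $A$ such that the semigroup is isomorphic to the quotient of $A^+$ by the congruence generated by $R$. -/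

import Mathlib

namespace StringRewriting

variable {α : Type*}

/-- The letters of a nonempty word, i.e. the inclusion of the free semigroup `A⁺` in the free
monoid `A*` of all finite words. -/
def letters (w : FreeSemigroup α) : List α := w.head :: w.tail

theorem letters_injective : Function.Injective (letters (α := α)) := by
  rintro ⟨a, l⟩ ⟨b, m⟩ h
  simp only [letters, List.cons.injEq] at h
  obtain ⟨rfl, rfl⟩ := h
  rfl

theorem letters_mul (v w : FreeSemigroup α) : letters (v * w) = letters v ++ letters w := by
  simp [letters]

/-- A rewriting system over the alphabet `α`: a set of rules `X → Y`, i.e. of pairs `(X, Y)` of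
nonempty words. -/
abbrev RewritingSystem (α : Type*) := Set (FreeSemigroup α × FreeSemigroup α)

namespace RewritingSystem

/-- One-step reduction: `W₁ = Z₁ X Z₂` and `W₂ = Z₁ Y Z₂` for some rule `X → Y` and some possibly
empty words `Z₁`, `Z₂`. -/
def Step (R : RewritingSystem α) (W₁ W₂ : FreeSemigroup α) : Prop :=
  ∃ X Y : FreeSemigroup α, (X, Y) ∈ R ∧ ∃ Z₁ Z₂ : List α,
    letters W₁ = Z₁ ++ letters X ++ Z₂ ∧ letters W₂ = Z₁ ++ letters Y ++ Z₂

/-- The reflexive transitive closure of one-step reduction. -/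
def Reduces (R : RewritingSystem α) : FreeSemigroup α → FreeSemigroup α → Prop :=
  Relation.ReflTransGen R.Step

/-- There is no infinite reduction sequence `W₀ → W₁ → W₂ → ⋯`. -/
def Noetherian (R : RewritingSystem α) : Prop :=
  ¬ ∃ W : ℕ → FreeSemigroup α, ∀ n, R.Step (W n) (W (n + 1))

/-- Two reducts of one word have a common reduct. -/
def Confluent (R : RewritingSystem α) : Prop :=
  ∀ U V W : FreeSemigroup α, R.Reduces U V → R.Reduces U W →
    ∃ X : FreeSemigroup α, R.Reduces V X ∧ R.Reduces W X

/-- A rewriting system is complete if it is Noetherian and confluent. -/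
def Complete (R : RewritingSystem α) : Prop := R.Noetherian ∧ R.Confluent

/-- The congruence on the free semigroup generated by the rules. -/
def congruence (R : RewritingSystem α) : Con (FreeSemigroup α) :=
  conGen fun X Y => (X, Y) ∈ R

/-- `S` is presented by `[α; R]`: it is isomorphic to the quotient of the free semigroup on `α`
by the congruence generated by `R`. -/
def Presents (R : RewritingSystem α) (S : Type*) [Semigroup S] : Prop :=
  Nonempty (R.congruence.Quotient ≃* S)

end RewritingSystem

/-- `S` has a presentation `[A; R]` with `A` and `R` finite and `R` complete. A finite alphabet can
be taken in `Type` without loss of generality. If `S` is nonempty, then the alphabet is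
automatically nonempty; the empty alphabet only presents the empty semigroup. -/
def HasFiniteCompleteRewritingSystem (S : Type*) [Semigroup S] : Prop :=
  ∃ (A : Type) (R : RewritingSystem A), Finite A ∧ R.Finite ∧ R.Complete ∧ R.Presents S

end StringRewriting

/-!
Let `K` be such that every irreducible word of length at least `K` represents an element of `T`;
there is one because only finitely many irreducible words represent elements outside `T`. The
letters of the new alphabet, called blocks, are the irreducible words of length less than `2 * K`
that represent elements of `T`. Cutting off prefixes of length `K`, the normal form of an element
of `T` is spelled by a unique balanced sequence of blocks, that is, a single block or a sequence in
which all blocks but the last have length `K` and the last has length at least `K`.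

The new rules replace a redex, which is a short sequence of blocks spelling a reducible word or an
unbalanced pair of neighbouring blocks, by the balanced sequence that spells the normal form. Each
such step either reduces the spelled word or rebalances the blocks without changing it, so the
process terminates. A left-hand side of an old rule meets only boundedly many blocks, hence the
irreducible sequences spell irreducible words and are balanced, so that distinct ones represent
distinct elements of `T`. This gives both confluence and the presentation.
-/

namespace StringRewriting

open FreeSemigroup (of lift)

variable {α ι : Type*}

theorem length_letters (w : FreeSemigroup α) : (letters w).length = w.length := rfl

theorem letters_ne_nil (w : FreeSemigroup α) : letters w ≠ [] := List.cons_ne_nil _ _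

theorem exists_letters_eq {l : List α} (hl : l ≠ []) : ∃ w, letters w = l := by
  obtain ⟨a, l, rfl⟩ := List.exists_cons_of_ne_nil hl
  exact ⟨⟨a, l⟩, rfl⟩

theorem letters_of_mul (a : α) (w : FreeSemigroup α) : letters (of a * w) = a :: letters w :=
  letters_mul _ _

theorem exists_eq_mul_of_lt_length {w : FreeSemigroup α} {k : ℕ} (hk : 0 < k)
    (hkw : k < w.length) : ∃ u v, w = u * v ∧ u.length = k := by
  have htake : ((letters w).take k).length = k := by
    rw [List.length_take, length_letters, min_eq_left hkw.le]
  have hdrop : ((letters w).drop k).length = w.length - k := List.length_drop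
  obtain ⟨u, hu⟩ := exists_letters_eq (List.ne_nil_of_length_pos (htake ▸ hk))
  obtain ⟨v, hv⟩ := exists_letters_eq (List.ne_nil_of_length_pos (hdrop ▸ Nat.sub_pos_of_lt hkw))
  refine ⟨u, v, letters_injective ?_, ?_⟩
  · rw [letters_mul, hu, hv, List.take_append_drop]
  · rw [← length_letters, hu, htake]

theorem finite_setOf_length_le [Finite α] (n : ℕ) : {w : FreeSemigroup α | w.length ≤ n}.Finite :=
  (List.finite_length_le α n).preimage letters_injective.injOn

/-- The word `P u Q`, where the possibly empty words `P`, `Q` surround the nonempty word `u`. It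
lets rewriting take place inside `A⁺`, without passing to words that may be empty. -/
def context (P Q : List α) (u : FreeSemigroup α) : FreeSemigroup α :=
  P.foldr (fun a w => of a * w) (Q.foldl (fun w a => w * of a) u)

theorem letters_context (P Q : List α) (u : FreeSemigroup α) :
    letters (context P Q u) = P ++ letters u ++ Q := by
  induction P with
  | nil =>
    induction Q generalizing u with
    | nil => simp [context]
    | cons a Q ih => exact (ih (u * of a)).trans (by simp [letters, of])
  | cons a P ih => exact (letters_of_mul a _).trans (congrArg (a :: ·) ih)

theorem eq_context_iff {P Q : List α} {u w : FreeSemigroup α} :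
    w = context P Q u ↔ letters w = P ++ letters u ++ Q := by
  rw [← letters_context, letters_injective.eq_iff]

theorem exists_eq_context_of_infix {u w : FreeSemigroup α} (h : letters u <:+: letters w) :
    ∃ P Q, w = context P Q u := by
  obtain ⟨P, Q, h⟩ := h
  exact ⟨P, Q, eq_context_iff.2 h.symm⟩

theorem mul_eq_context_left (u v : FreeSemigroup α) : u * v = context [] (letters v) u :=
  eq_context_iff.2 (letters_mul u v)

theorem mul_eq_context_right (u v : FreeSemigroup α) : u * v = context (letters u) [] v :=
  eq_context_iff.2 (by rw [letters_mul, List.append_nil])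

theorem context_context (P Q P' Q' : List α) (u : FreeSemigroup α) :
    context P Q (context P' Q' u) = context (P ++ P') (Q' ++ Q) u :=
  eq_context_iff.2 (by simp only [letters_context, List.append_assoc])

theorem con_context (c : Con (FreeSemigroup α)) {u v : FreeSemigroup α} (h : c u v)
    (P Q : List α) : c (context P Q u) (context P Q v) := by
  induction P with
  | nil =>
    induction Q generalizing u v with
    | nil => exact h
    | cons a _ ih => exact ih (c.mul h (c.refl _))
  | cons a P ih => exact c.mul (c.refl _) ih

theorem letters_lift (f : ι → FreeSemigroup α) (β : FreeSemigroup ι) :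
    letters (lift f β) = (letters β).flatMap fun i => letters (f i) := by
  induction β using FreeSemigroup.recOnMul with
  | ih1 i => exact (List.append_nil _).symm
  | ih2 i β _ ih => rw [FreeSemigroup.lift_of_mul, letters_mul, ih, letters_of_mul,
      List.flatMap_cons]

theorem lift_context (f : ι → FreeSemigroup α) (P Q : List ι) (β : FreeSemigroup ι) :
    lift f (context P Q β) = context (P.flatMap fun i => letters (f i))
      (Q.flatMap fun i => letters (f i)) (lift f β) :=
  eq_context_iff.2 (by simp only [letters_lift, letters_context, List.flatMap_append])

theorem lift_mem {S : Type*} [Semigroup S] (T : Subsemigroup S) {f : ι → S} (hf : ∀ i, f i ∈ T)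
    (β : FreeSemigroup ι) : lift f β ∈ T := by
  induction β using FreeSemigroup.recOnMul with
  | ih1 i => exact hf i
  | ih2 i β _ ih => exact FreeSemigroup.lift_of_mul f i β ▸ T.mul_mem (hf i) ih

namespace RewritingSystem

variable {R : RewritingSystem α} {u v w : FreeSemigroup α} {S : Type*} [Semigroup S]
  {φ : FreeSemigroup α →ₙ* S}

/-- A word to which no rule applies, i.e. a normal form for reduction. -/
def IsIrreducible (R : RewritingSystem α) (u : FreeSemigroup α) : Prop := ∀ v, ¬ R.Step u v

theorem step_iff : R.Step u v ↔
    ∃ X Y, (X, Y) ∈ R ∧ ∃ P Q, u = context P Q X ∧ v = context P Q Y := by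
  simp only [Step, eq_context_iff]

theorem Step.context (h : R.Step u v) (P Q : List α) :
    R.Step (context P Q u) (context P Q v) := by
  obtain ⟨X, Y, hXY, P', Q', rfl, rfl⟩ := step_iff.1 h
  exact step_iff.2 ⟨X, Y, hXY, P ++ P', Q' ++ Q, context_context .., context_context ..⟩

theorem Reduces.context (h : R.Reduces u v) (P Q : List α) :
    R.Reduces (context P Q u) (context P Q v) :=
  h.lift _ fun _ _ h => h.context P Q

theorem Reduces.mul {u' v' : FreeSemigroup α} (h : R.Reduces u v) (h' : R.Reduces u' v') :
    R.Reduces (u * u') (v * v') := by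
  have hl : R.Reduces (u * u') (v * u') := by
    simpa only [mul_eq_context_left] using h.context [] (letters u')
  have hr : R.Reduces (v * u') (v * v') := by
    simpa only [mul_eq_context_right] using h'.context (letters v) []
  exact hl.trans hr

theorem IsIrreducible.of_infix (hv : R.IsIrreducible v) (h : letters u <:+: letters v) :
    R.IsIrreducible u := by
  obtain ⟨P, Q, rfl⟩ := exists_eq_context_of_infix h
  exact fun w hw => hv _ (hw.context P Q)

theorem IsIrreducible.notMem_of_infix {X Y : FreeSemigroup α} (hu : R.IsIrreducible u)
    (h : letters X <:+: letters u) : (X, Y) ∉ R := fun hXY => by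
  obtain ⟨P, Q, rfl⟩ := exists_eq_context_of_infix h
  exact hu _ (step_iff.2 ⟨X, Y, hXY, P, Q, rfl, rfl⟩)

theorem IsIrreducible.of_mul_left (h : R.IsIrreducible (u * v)) : R.IsIrreducible u :=
  h.of_infix (letters_mul u v ▸ List.infix_append_left)

theorem IsIrreducible.of_mul_right (h : R.IsIrreducible (u * v)) : R.IsIrreducible v :=
  h.of_infix (letters_mul u v ▸ List.infix_append_right)

theorem IsIrreducible.eq_of_reduces (hu : R.IsIrreducible u) (h : R.Reduces u v) : u = v :=
  h.cases_head.resolve_right fun ⟨w, hw, _⟩ => hu w hw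

theorem noetherian_iff_wellFounded : R.Noetherian ↔ WellFounded (Function.swap R.Step) := by
  rw [wellFounded_iff_isEmpty_descending_chain, isEmpty_subtype, Noetherian, not_exists]

theorem Noetherian.exists_irreducible (hR : R.Noetherian) (u : FreeSemigroup α) :
    ∃ v, R.Reduces u v ∧ R.IsIrreducible v := by
  obtain ⟨v, huv, hv⟩ := (noetherian_iff_wellFounded.1 hR).has_min {v | R.Reduces u v} ⟨u, .refl⟩
  exact ⟨v, huv, fun w hvw => hv w (huv.tail hvw) hvw⟩

theorem Reduces.congruence (h : R.Reduces u v) : R.congruence u v := by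
  induction h with
  | refl => exact R.congruence.refl _
  | tail _ hstep ih =>
    obtain ⟨X, Y, hXY, P, Q, rfl, rfl⟩ := step_iff.1 hstep
    exact R.congruence.trans ih (con_context _ (ConGen.Rel.of _ _ hXY) P Q)

theorem Confluent.join_of_congruence (hR : R.Confluent) (h : R.congruence u v) :
    Relation.Join R.Reduces u v := by
  let c : Con (FreeSemigroup α) :=
    { r := Relation.Join R.Reduces
      iseqv := Relation.equivalence_join (r := Relation.ReflTransGen R.Step) hR
      mul' := fun ⟨x, hx, hx'⟩ ⟨y, hy, hy'⟩ => ⟨x * y, hx.mul hy, hx'.mul hy'⟩ }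
  have hc : R.congruence ≤ c := Con.conGen_le.2 fun X Y hXY =>
    ⟨Y, .single (step_iff.2 ⟨X, Y, hXY, [], [], rfl, rfl⟩), .refl⟩
  exact hc h

theorem presents_iff : R.Presents S ↔
    ∃ φ : FreeSemigroup α →ₙ* S, Function.Surjective φ ∧ Con.ker φ = R.congruence := by
  constructor
  · rintro ⟨e⟩
    refine ⟨(e : R.congruence.Quotient →ₙ* S).comp R.congruence.mkMulHom,
      e.surjective.comp Quotient.mk_surjective, Con.ext fun u v => ?_⟩
    exact e.injective.eq_iff.trans (Con.eq _)
  · rintro ⟨φ, hφ, hker⟩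
    rw [Presents, ← hker]
    exact ⟨{ Setoid.quotientKerEquivOfSurjective φ hφ with
      map_mul' := by rintro ⟨u⟩ ⟨v⟩; exact map_mul φ u v }⟩

theorem Confluent.injOn_irreducible (hR : R.Confluent) (hφ : Con.ker φ ≤ R.congruence) :
    Set.InjOn φ {u | R.IsIrreducible u} := by
  intro u hu v hv huv
  obtain ⟨w, huw, hvw⟩ := hR.join_of_congruence (hφ huv)
  exact (hu.eq_of_reduces huw).trans (hv.eq_of_reduces hvw).symm

theorem Noetherian.join_of_map_eq (hR : R.Noetherian) (hφ : R.congruence ≤ Con.ker φ)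
    (hinj : Set.InjOn φ {u | R.IsIrreducible u}) (h : φ u = φ v) :
    Relation.Join R.Reduces u v := by
  obtain ⟨u', hu, hu'⟩ := hR.exists_irreducible u
  obtain ⟨v', hv, hv'⟩ := hR.exists_irreducible v
  have huv' : φ u' = φ v' :=
    calc φ u' = φ u := (hφ hu.congruence).symm
      _ = φ v := h
      _ = φ v' := hφ hv.congruence
  exact ⟨u', hu, hinj hu' hv' huv' ▸ hv⟩

theorem Noetherian.confluent (hR : R.Noetherian) (hφ : R.congruence ≤ Con.ker φ)
    (hinj : Set.InjOn φ {u | R.IsIrreducible u}) : R.Confluent := fun _ _ _ hV hW =>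
  hR.join_of_map_eq hφ hinj ((hφ hV.congruence).symm.trans (hφ hW.congruence))

theorem Noetherian.presents (hR : R.Noetherian) (hφ : R.congruence ≤ Con.ker φ)
    (hinj : Set.InjOn φ {u | R.IsIrreducible u}) (hsurj : Function.Surjective φ) :
    R.Presents S := by
  refine presents_iff.2 ⟨φ, hsurj, le_antisymm (fun u v huv => ?_) hφ⟩
  obtain ⟨w, huw, hvw⟩ := hR.join_of_map_eq hφ hinj huv
  exact R.congruence.trans huw.congruence (R.congruence.symm hvw.congruence)

end RewritingSystem

theorem exists_short_prefix_of_prefix_flatMap {f : ι → List α} (hf : ∀ i, f i ≠ []) {x : List α}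
    {L : List ι} (h : x <+: L.flatMap f) :
    ∃ C, C <+: L ∧ C.length ≤ x.length ∧ x <+: C.flatMap f := by
  induction L generalizing x with
  | nil => exact ⟨[], List.prefix_rfl, Nat.zero_le _, h⟩
  | cons i L ih =>
    rw [List.flatMap_cons] at h
    rcases List.prefix_or_prefix_of_prefix h (List.prefix_append _ _) with hx | ⟨y, rfl⟩
    · rcases eq_or_ne x [] with rfl | hne
      · exact ⟨[], List.nil_prefix, le_rfl, List.nil_prefix⟩
      · exact ⟨[i], by simp, List.length_pos_of_ne_nil hne, by simpa using hx⟩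
    · obtain ⟨C, hCL, hC, hy⟩ := ih ((List.prefix_append_right_inj _).1 h)
      have hi : 0 < (f i).length := List.length_pos_of_ne_nil (hf i)
      refine ⟨i :: C, by simpa using hCL, ?_, by simpa using hy⟩
      rw [List.length_cons, List.length_append]
      omega

theorem exists_short_infix_of_infix_flatMap {f : ι → List α} (hf : ∀ i, f i ≠ []) {x : List α}
    {L : List ι} (h : x <:+: L.flatMap f) :
    ∃ C, C <:+: L ∧ C.length ≤ x.length + 1 ∧ x <:+: C.flatMap f := by
  induction L with
  | nil => exact ⟨[], List.infix_rfl, Nat.zero_le _, h⟩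
  | cons i L ih =>
    rw [List.flatMap_cons, List.infix_append_iff] at h
    rcases h with hx | hx | ⟨y, z, rfl, hy, hz⟩
    · exact ⟨[i], (List.prefix_append [i] L).isInfix, by simp, by simpa using hx⟩
    · obtain ⟨C, hCL, hC, hxC⟩ := ih hx
      exact ⟨C, hCL.trans (List.suffix_cons i L).isInfix, hC, hxC⟩
    · obtain ⟨C, hCL, hC, hzC⟩ := exists_short_prefix_of_prefix_flatMap hf hz
      refine ⟨i :: C, List.IsPrefix.isInfix (by simpa using hCL), ?_, ?_⟩
      · rw [List.length_cons, List.length_append]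
        omega
      · rw [List.flatMap_cons]
        exact List.infix_append_iff.2 (.inr (.inr ⟨y, z, rfl, hy, hzC⟩))

section Balanced

variable {f : ι → FreeSemigroup α} {K : ℕ}

/-- The relation between neighbouring blocks in a balanced sequence of blocks `f i`. A nonempty
sequence of blocks of length less than `2 * K` is a chain for this relation if and only if it is a
single block or all its blocks but the last have length `K` and the last has length at least
`K`. -/
def IsBalanced (f : ι → FreeSemigroup α) (K : ℕ) (i j : ι) : Prop :=
  (f i).length = K ∧ K ≤ (f j).length

theorem le_length_head_of_isChain {β : FreeSemigroup ι}
    (hβ : (letters β).IsChain (IsBalanced f K)) (hK : K ≤ (lift f β).length) :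
    K ≤ (f β.head).length := by
  obtain ⟨i, L⟩ := β
  cases L with
  | nil => exact hK
  | cons j L => exact (List.isChain_cons_cons.1 hβ).1.1.ge

theorem eq_of_flatMap_eq_of_isChain (hf : Function.Injective f) (hK : ∀ i, (f i).length < 2 * K)
    {L L' : List ι} (hL : L.IsChain (IsBalanced f K)) (hL' : L'.IsChain (IsBalanced f K))
    (h : (L.flatMap fun i => letters (f i)) = L'.flatMap fun i => letters (f i)) : L = L' := by
  have single_ne {i j k : ι} {L : List ι} (hL : (j :: k :: L).IsChain (IsBalanced f K)) :
      ([i].flatMap fun i => letters (f i)) ≠ (j :: k :: L).flatMap fun i => letters (f i) := by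
    intro h
    obtain ⟨hj, hk⟩ := (List.isChain_cons_cons.1 hL).1
    have hi := hK i
    have hlen := congrArg List.length h
    simp only [List.flatMap_cons, List.flatMap_nil, List.length_append, List.length_nil,
      length_letters] at hlen
    omega
  induction L generalizing L' with
  | nil =>
    cases L' with
    | nil => rfl
    | cons j L' => simp [letters] at h
  | cons i L ih =>
    rcases L, L' with ⟨_ | ⟨i', L⟩, _ | ⟨j, _ | ⟨j', L'⟩⟩⟩
    · simp [letters] at h
    · simpa [letters_injective.eq_iff, hf.eq_iff] using h
    · exact absurd h (single_ne hL')
    · simp [letters] at h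
    · exact absurd h.symm (single_ne hL)
    · rw [List.isChain_cons_cons] at hL hL'
      rw [List.flatMap_cons, List.flatMap_cons (x := j)] at h
      obtain ⟨hij, htail⟩ := List.append_inj h (hL.1.1.trans hL'.1.1.symm)
      rw [hf (letters_injective hij), ih hL.2 hL'.2 htail]

/-- A polynomial interpretation that proves termination of rebalancing: a block of length `K` acts
as `x ↦ x + 1` and any other block as `x ↦ 2 * x + 2`. Replacing an unbalanced pair of blocks by a
balanced sequence decreases the value at every `x`, and the interpretations are strictly monotone,
so this may be done anywhere inside a sequence of blocks. -/
def cost (f : ι → FreeSemigroup α) (K : ℕ) : List ι → ℕ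
  | [] => 0
  | i :: L => if (f i).length = K then cost f K L + 1 else 2 * cost f K L + 2

theorem cost_append_lt {L L' : List ι} (P : List ι) (h : cost f K L < cost f K L') :
    cost f K (P ++ L) < cost f K (P ++ L') := by
  induction P with
  | nil => exact h
  | cons i P ih =>
    simp only [List.cons_append, cost]
    split_ifs <;> omega

theorem cost_append_lt_of_isChain (hK : ∀ i, (f i).length < 2 * K) {i j : ι} {L : List ι}
    (hij : ¬ IsBalanced f K i j) (hL : L.IsChain (IsBalanced f K))
    (hlen : (L.map fun k => (f k).length).sum = (f i).length + (f j).length) (Q : List ι) :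
    cost f K (L ++ Q) < cost f K (i :: j :: Q) := by
  have hi := hK i
  have hj := hK j
  unfold IsBalanced at hij
  match L with
  | [] =>
    simp only [List.nil_append, cost]
    split_ifs <;> omega
  | [a] =>
    simp only [List.map_cons, List.map_nil, List.sum_cons, List.sum_nil, List.cons_append,
      List.nil_append, cost] at hlen ⊢
    split_ifs <;> omega
  | [a, b] =>
    obtain ⟨ha, hb⟩ := List.isChain_pair.1 hL
    simp only [List.map_cons, List.map_nil, List.sum_cons, List.sum_nil, List.cons_append,
      List.nil_append, cost] at hlen ⊢
    split_ifs <;> omega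
  | [a, b, c] =>
    rw [List.isChain_cons_cons, List.isChain_pair] at hL
    obtain ⟨⟨ha, -⟩, hb, hc⟩ := hL
    simp only [List.map_cons, List.map_nil, List.sum_cons, List.sum_nil, List.cons_append,
      List.nil_append, cost] at hlen ⊢
    split_ifs <;> omega
  | a :: b :: c :: d :: L =>
    simp only [List.isChain_cons_cons] at hL
    obtain ⟨⟨ha, -⟩, ⟨hb, -⟩, ⟨hc, hd⟩, -⟩ := hL
    simp only [List.map_cons, List.sum_cons] at hlen
    omega

end Balanced

section Blocks

variable {W : Set (FreeSemigroup α)} {K : ℕ}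

/-- The words in `W` of length less than `2 * K`, which become the letters of a new alphabet. -/
def blocks (W : Set (FreeSemigroup α)) (K : ℕ) : Set (FreeSemigroup α) :=
  {w ∈ W | w.length < 2 * K}

theorem finite_blocks [Finite α] (W : Set (FreeSemigroup α)) (K : ℕ) : (blocks W K).Finite :=
  (finite_setOf_length_le (2 * K)).subset fun _ hw => hw.2.le

theorem exists_balanced_lift_eq (hK : 0 < K)
    (hW : ∀ u v, u * v ∈ W → K ≤ u.length → K ≤ v.length → u ∈ W ∧ v ∈ W)
    {w : FreeSemigroup α} (hw : w ∈ W) :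
    ∃ β : FreeSemigroup (blocks W K), lift Subtype.val β = w ∧
      (letters β).IsChain (IsBalanced Subtype.val K) := by
  induction hm : w.length using Nat.strong_induction_on generalizing w with
  | _ m ih =>
    rcases lt_or_ge w.length (2 * K) with hlt | hge
    · exact ⟨of ⟨w, hw, hlt⟩, rfl, List.isChain_singleton _⟩
    · obtain ⟨u, v, rfl, hu⟩ := exists_eq_mul_of_lt_length (w := w) hK (by omega)
      rw [FreeSemigroup.length_mul] at hm hge
      obtain ⟨huW, hvW⟩ := hW u v hw hu.ge (by omega)
      obtain ⟨β, rfl, hβ⟩ := ih v.length (by omega) hvW rfl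
      refine ⟨of ⟨u, huW, by omega⟩ * β, FreeSemigroup.lift_of_mul _ _ _, ?_⟩
      rw [letters_of_mul]
      exact List.isChain_cons_cons.2 ⟨⟨hu, le_length_head_of_isChain hβ (by omega)⟩, hβ⟩

end Blocks

namespace RewritingSystem

variable {R : RewritingSystem α} {f : ι → FreeSemigroup α} {K n : ℕ}
  {g : FreeSemigroup ι → FreeSemigroup ι} {β γ : FreeSemigroup ι}

/-- `g` sends each sequence of blocks `f i` to a balanced sequence of blocks that spells an
`R`-normal form of the same word. -/
structure IsNormalizer (R : RewritingSystem α) (f : ι → FreeSemigroup α) (K : ℕ)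
    (g : FreeSemigroup ι → FreeSemigroup ι) : Prop where
  reduces (γ : FreeSemigroup ι) : R.Reduces (lift f γ) (lift f (g γ))
  irreducible (γ : FreeSemigroup ι) : R.IsIrreducible (lift f (g γ))
  balanced (γ : FreeSemigroup ι) : (letters (g γ)).IsChain (IsBalanced f K)

/-- The left-hand sides of the rules of `blockSystem`: the sequences of at most `n` blocks that
spell a reducible word, and the unbalanced pairs of blocks. -/
def blockRedexes (R : RewritingSystem α) (f : ι → FreeSemigroup α) (K n : ℕ) :
    Set (FreeSemigroup ι) :=
  {γ | γ.length ≤ n ∧ ¬ R.IsIrreducible (lift f γ)} ∪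
    {γ | ∃ i j, γ = of i * of j ∧ ¬ IsBalanced f K i j}

/-- The rewriting system over the alphabet of blocks that applies `g` to every redex. -/
def blockSystem (R : RewritingSystem α) (f : ι → FreeSemigroup α) (K n : ℕ)
    (g : FreeSemigroup ι → FreeSemigroup ι) : RewritingSystem ι :=
  (fun γ => (γ, g γ)) '' R.blockRedexes f K n

theorem blockSystem_finite [Finite ι] : (R.blockSystem f K n g).Finite := by
  have hred : {γ : FreeSemigroup ι | γ.length ≤ n ∧ ¬ R.IsIrreducible (lift f γ)}.Finite :=
    (finite_setOf_length_le n).subset fun _ h => h.1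
  have hpair : {γ | ∃ i j, γ = of i * of j ∧ ¬ IsBalanced f K i j}.Finite :=
    (finite_setOf_length_le 2).subset fun _ ⟨_, _, h, _⟩ => h ▸ le_refl 2
  exact (hred.union hpair).image _

theorem IsNormalizer.reduces_of_mem (hg : R.IsNormalizer f K g) {X Y : FreeSemigroup ι}
    (h : (X, Y) ∈ R.blockSystem f K n g) : R.Reduces (lift f X) (lift f Y) := by
  obtain ⟨γ, -, h⟩ := h
  obtain ⟨rfl, rfl⟩ := Prod.mk.inj h
  exact hg.reduces γ

theorem IsNormalizer.cost_lt_of_step (hg : R.IsNormalizer f K g)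
    (hK : ∀ i, (f i).length < 2 * K) (h : (R.blockSystem f K n g).Step β γ) :
    Relation.TransGen R.Step (lift f β) (lift f γ) ∨
      lift f γ = lift f β ∧ cost f K (letters γ) < cost f K (letters β) := by
  obtain ⟨X, _, ⟨_, hX, ⟨⟩⟩, P, Q, rfl, rfl⟩ := step_iff.1 h
  rw [lift_context, lift_context]
  rcases Relation.reflTransGen_iff_eq_or_transGen.1 (hg.reduces X) with heq | htrans
  · obtain ⟨i, j, rfl, hij⟩ := hX.resolve_left fun hX => hX.2 (heq ▸ hg.irreducible X)
    refine .inr ⟨congrArg _ heq, ?_⟩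
    have hlen := congrArg FreeSemigroup.length heq
    simp only [← length_letters, letters_lift, List.length_flatMap, letters_mul] at hlen
    rw [letters_context, letters_context, List.append_assoc, List.append_assoc]
    exact cost_append_lt P (cost_append_lt_of_isChain hK hij (hg.balanced _) hlen Q)
  · exact .inl (htrans.lift _ fun _ _ h => h.context _ _)

theorem IsNormalizer.noetherian_blockSystem (hg : R.IsNormalizer f K g)
    (hK : ∀ i, (f i).length < 2 * K) (hR : R.Noetherian) :
    (R.blockSystem f K n g).Noetherian := by
  rw [noetherian_iff_wellFounded] at hR ⊢
  have hlex := WellFounded.prod_lex hR.transGen Nat.lt_wfRel.wf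
  refine Subrelation.wf (fun {γ β} h => ?_) (InvImage.wf
    (fun β : FreeSemigroup ι => (lift f β, cost f K (letters β))) hlex)
  rcases hg.cost_lt_of_step hK h with htrans | ⟨heq, hlt⟩
  · exact .left _ _ (Relation.transGen_swap.2 htrans)
  · exact Prod.lex_def.2 (.inr ⟨heq, hlt⟩)

theorem IsIrreducible.notMem_blockRedexes (hβ : (R.blockSystem f K n g).IsIrreducible β)
    (h : letters γ <:+: letters β) : γ ∉ R.blockRedexes f K n := fun hγ =>
  hβ.notMem_of_infix h ⟨γ, hγ, rfl⟩

theorem IsIrreducible.lift_of_blockSystem (hn : ∀ p ∈ R, p.1.length < n)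
    (hβ : (R.blockSystem f K n g).IsIrreducible β) : R.IsIrreducible (lift f β) := by
  intro v hv
  obtain ⟨X, Y, hXY, P, Q, hX, -⟩ := hv
  have hinfix : letters X <:+: (letters β).flatMap fun i => letters (f i) :=
    letters_lift f β ▸ ⟨P, Q, hX.symm⟩
  obtain ⟨C, hCβ, hC, hXC⟩ :=
    exists_short_infix_of_infix_flatMap (fun i => letters_ne_nil (f i)) hinfix
  have hC0 : C ≠ [] := by
    rintro rfl
    exact letters_ne_nil X (List.infix_nil.1 hXC)
  obtain ⟨γ, rfl⟩ := exists_letters_eq hC0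
  rw [← letters_lift] at hXC
  exact hβ.notMem_blockRedexes hCβ
    (.inl ⟨hC.trans (hn _ hXY), fun hγ => hγ.notMem_of_infix hXC hXY⟩)

theorem IsIrreducible.isChain_of_blockSystem (hβ : (R.blockSystem f K n g).IsIrreducible β) :
    (letters β).IsChain (IsBalanced f K) := by
  rw [List.isChain_iff_forall_rel_of_append_cons_cons]
  intro i j P Q h
  by_contra hij
  refine hβ.notMem_blockRedexes (γ := of i * of j) ⟨P, Q, ?_⟩ (.inr ⟨i, j, rfl, hij⟩)
  rw [h]
  exact List.append_assoc P [i, j] Q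

theorem injOn_lift_irreducible_blockSystem (hf : Function.Injective f)
    (hK : ∀ i, (f i).length < 2 * K) :
    Set.InjOn (lift f) {β | (R.blockSystem f K n g).IsIrreducible β} := by
  intro β hβ γ hγ h
  refine letters_injective (eq_of_flatMap_eq_of_isChain hf hK
    (IsIrreducible.isChain_of_blockSystem hβ) (IsIrreducible.isChain_of_blockSystem hγ) ?_)
  rw [← letters_lift, ← letters_lift, h]

end RewritingSystem

section LongIrreducibles

variable {S : Type*} [Semigroup S] {R : RewritingSystem α} {φ : FreeSemigroup α →ₙ* S}
  {T : Subsemigroup S} {K n : ℕ}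

theorem exists_length_bound (hinj : Set.InjOn φ {u | R.IsIrreducible u})
    (hT : ((T : Set S)ᶜ).Finite) :
    ∃ K, 0 < K ∧ ∀ u, R.IsIrreducible u → K ≤ u.length → φ u ∈ T := by
  have hfin : {u | R.IsIrreducible u ∧ φ u ∉ T}.Finite :=
    Set.Finite.of_finite_image (f := φ) (hT.subset (by rintro _ ⟨u, hu, rfl⟩; exact hu.2))
      (hinj.mono fun u hu => hu.1)
  obtain ⟨N, hN⟩ := (hfin.image FreeSemigroup.length).bddAbove
  refine ⟨N + 1, N.succ_pos, fun u hu hlen => ?_⟩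
  by_contra h
  exact hlen.not_gt (Nat.lt_succ_of_le (hN ⟨u, ⟨hu, h⟩, rfl⟩))

/-- The `R`-normal forms of the elements of `T`, where `φ` evaluates words in the semigroup that
`R` presents. -/
def normalForms (R : RewritingSystem α) (φ : FreeSemigroup α →ₙ* S) (T : Subsemigroup S) :
    Set (FreeSemigroup α) :=
  {u | R.IsIrreducible u ∧ φ u ∈ T}

theorem exists_balanced_of_mem_normalForms (hK : 0 < K)
    (hlong : ∀ u, R.IsIrreducible u → K ≤ u.length → φ u ∈ T) {w : FreeSemigroup α}
    (hw : w ∈ normalForms R φ T) :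
    ∃ β : FreeSemigroup (blocks (normalForms R φ T) K), lift Subtype.val β = w ∧
      (letters β).IsChain (IsBalanced Subtype.val K) :=
  exists_balanced_lift_eq (W := normalForms R φ T) hK (fun u v huv hu hv =>
    ⟨⟨huv.1.of_mul_left, hlong u huv.1.of_mul_left hu⟩,
      ⟨huv.1.of_mul_right, hlong v huv.1.of_mul_right hv⟩⟩) hw

/-- The evaluation in `T` of sequences of blocks that represent elements of `T`. -/
def blockEval (R : RewritingSystem α) (φ : FreeSemigroup α →ₙ* S) (T : Subsemigroup S) (K : ℕ) :
    FreeSemigroup (blocks (normalForms R φ T) K) →ₙ* T :=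
  (φ.comp (lift Subtype.val)).codRestrict T (lift_mem (T.comap φ) fun b => b.2.1.2)

theorem exists_isNormalizer (hR : R.Noetherian) (hφ : R.congruence ≤ Con.ker φ) (hK : 0 < K)
    (hlong : ∀ u, R.IsIrreducible u → K ≤ u.length → φ u ∈ T) :
    ∃ g, R.IsNormalizer (Subtype.val : blocks (normalForms R φ T) K → FreeSemigroup α) K g := by
  have hex (γ : FreeSemigroup (blocks (normalForms R φ T) K)) :
      ∃ δ : FreeSemigroup (blocks (normalForms R φ T) K),
        R.Reduces (lift Subtype.val γ) (lift Subtype.val δ) ∧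
        R.IsIrreducible (lift Subtype.val δ) ∧
        (letters δ).IsChain (IsBalanced Subtype.val K) := by
    obtain ⟨w, hγw, hw⟩ := hR.exists_irreducible (lift Subtype.val γ)
    have hwT : φ w ∈ T := hφ hγw.congruence ▸ (blockEval R φ T K γ).2
    obtain ⟨δ, rfl, hδ⟩ := exists_balanced_of_mem_normalForms hK hlong ⟨hw, hwT⟩
    exact ⟨δ, hγw, hw, hδ⟩
  choose g hred hirr hbal using hex
  exact ⟨g, hred, hirr, hbal⟩

theorem blockEval_surjective (hR : R.Noetherian) (hφ : R.congruence ≤ Con.ker φ)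
    (hsurj : Function.Surjective φ) (hK : 0 < K)
    (hlong : ∀ u, R.IsIrreducible u → K ≤ u.length → φ u ∈ T) :
    Function.Surjective (blockEval R φ T K) := by
  rintro ⟨t, ht⟩
  obtain ⟨u, rfl⟩ := hsurj t
  obtain ⟨w, huw, hw⟩ := hR.exists_irreducible u
  have hφw : φ u = φ w := hφ huw.congruence
  obtain ⟨β, rfl, -⟩ := exists_balanced_of_mem_normalForms hK hlong ⟨hw, hφw ▸ ht⟩
  exact ⟨β, Subtype.ext hφw.symm⟩

theorem congruence_blockSystem_le_ker (hφ : R.congruence ≤ Con.ker φ)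
    {g : FreeSemigroup (blocks (normalForms R φ T) K) →
      FreeSemigroup (blocks (normalForms R φ T) K)}
    (hg : R.IsNormalizer Subtype.val K g) :
    (R.blockSystem Subtype.val K n g).congruence ≤ Con.ker (blockEval R φ T K) :=
  Con.conGen_le.2 fun _ _ hXY => Subtype.ext (hφ (hg.reduces_of_mem hXY).congruence)

theorem injOn_blockEval_irreducible (hn : ∀ p ∈ R, p.1.length < n)
    (hinj : Set.InjOn φ {u | R.IsIrreducible u})
    {g : FreeSemigroup (blocks (normalForms R φ T) K) →
      FreeSemigroup (blocks (normalForms R φ T) K)} :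
    Set.InjOn (blockEval R φ T K) {β | (R.blockSystem Subtype.val K n g).IsIrreducible β} := by
  have hlift := RewritingSystem.injOn_lift_irreducible_blockSystem (R := R) (K := K) (n := n)
    (g := g) Subtype.val_injective fun b => b.2.2
  have hcomp := hinj.comp hlift fun β hβ => RewritingSystem.IsIrreducible.lift_of_blockSystem hn hβ
  exact fun β hβ γ hγ h => hcomp hβ hγ (congrArg Subtype.val h)

end LongIrreducibles

end StringRewriting

open StringRewriting RewritingSystem

theorem theorem1p1 {S : Type*} [Semigroup S] (T : Subsemigroup S)
    (hT : ((T : Set S)ᶜ).Finite)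
    (hS : StringRewriting.HasFiniteCompleteRewritingSystem S) :
    StringRewriting.HasFiniteCompleteRewritingSystem T := by
  obtain ⟨A, R, hA, hfin, ⟨hnoeth, hconf⟩, hpres⟩ := hS
  obtain ⟨φ, hsurj, hker⟩ := presents_iff.1 hpres
  have hinj := hconf.injOn_irreducible hker.le
  obtain ⟨K, hK, hlong⟩ := exists_length_bound hinj hT
  obtain ⟨N, hN⟩ := (hfin.image fun p => p.1.length).bddAbove
  have hn : ∀ p ∈ R, p.1.length < N + 1 := fun p hp => Nat.lt_succ_of_le (hN ⟨p, hp, rfl⟩)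
  obtain ⟨g, hg⟩ := exists_isNormalizer hnoeth hker.ge hK hlong
  have hnoeth' := hg.noetherian_blockSystem (n := N + 1) (fun b => b.2.2) hnoeth
  have hcong := congruence_blockSystem_le_ker (n := N + 1) hker.ge hg
  have hinj' := injOn_blockEval_irreducible (T := T) (K := K) (g := g) hn hinj
  have hB : Finite (blocks (normalForms R φ T) K) := (finite_blocks _ K).to_subtype
  exact ⟨blocks (normalForms R φ T) K, R.blockSystem Subtype.val K (N + 1) g, hB,
    blockSystem_finite, ⟨hnoeth', hnoeth'.confluent hcong hinj'⟩,
    hnoeth'.presents hcong hinj' (blockEval_surjective hnoeth hker.ge hsurj hK hlong)⟩
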